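/- **Setting.** Consider the uncertain system $x^+=Ax+Bu+w$, $x\in\mathbb R^{n}$, $u\in\mathbb R^{m}$, where at every step $(A,B)\in\mathcal M:=\mathrm{conv}\{(A_i,B_i):i=1,\dots,n_p\}$, $n_p\ge 1$, and $w\in\mathsf W$ are arbitrary. Let $\mathbb X\subset\mathbb R^n$, $\mathbb U\subset\mathbb R^m$ and $\mathsf W,\overline{\mathsf W}=\mathrm{conv}\{w_1,\dots,w_{n_{\bar w}}\},\underline{\mathsf W}\subset\mathbb R^n$ be (bounded, nonempty) polytopes with $0\in\mathrm{int}\,\mathsf W$, $0\in\overline{\mathsf W}$, $0\in\underline{\mathsf W}$ (possibly $\underline{\mathsf W}=\{0\}$) and $\mathsf W\subseteq\overline{\mathsf W}\oplus\underline{\mathsf W}$. Let $\oplus$ be the Minkowski sum, $P\ominus Q=\{z: z+y\in P\ \forall y\in Q\}$, $n_d=n_pn_{\bar w}$, and let $0\le N_r\le N_p$, $N_p\ge 1$. A gain $K$ is called stabilizing if $x^+=(A+BK)x$ is (uniformly exponentially) stable for arbitrarily varying $(A,B)\in\mathcal M$, i.e. its joint spectral radius is less than one. $K_{\mathrm{inv}}$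 is a stabilizing gain, and $K_f$ is the common gain of the terminal controller and of the predicted tubes. A set $T$ is robust positively invariant (RPI) for a set $M$ of pairs, a gain $K$ and a set $D$ of disturbances if $(A+BK)x+w\in T$ for all $x\in T$, $(A,B)\in M$, $w\in D$. The predicted tubes are taken from a class $\mathcal T$ of nonempty compact convex sets with $aZ_1\oplus bZ_2\in\mathcal T$ whenever $Z_1,Z_2\in\mathcal T$, $a,b\ge 0$, $a+b=1$ (for instance all polytopes, or all homothets $\hat z\oplus\alpha\Lambda$, $\alpha\ge0$, of a polytope $\Lambda$). **Optimization problem at $x$.** Put $\mathbb Z=\mathbb X\ominus\mathsf S$, $\mathbb V=\mathbb U\ominus K_{\mathrm{inv}}\mathsf S$. A scenario tree has $n_d^k$ nodes $(j,k)$ at each stage $k\le N_r$, every node of stage $k<N_r$ having one child for each realization $(i,l)$. Its variables are states $z_k^j$ ($k\le N_r$) with root $z_0$, inputs $v_k^j$ ($k<N_r$), and for each node $j$ at stage $N_r$ tubes $\mathsf Z_k^j\in\mathcal T$ ($N_r\le k\le N_p$) and feed-forward terms $v_k^j$ ($N_r\le k<N_p$). The constraints are: $x\in\{z_0\}\oplus\mathsf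 S$; for $k<N_r$, $z_k^j\in\mathbb Z$, $v_k^j\in\mathbb V$, and the child of $(j,k)$ for $(i,l)$ is $A_iz_k^j+B_iv_k^j+w_l$; $z_{N_r}^j\in\mathsf Z_{N_r}^j\subseteq\mathbb Z$; for $N_r\le k<N_p$, $(A_i+B_iK_f)\mathsf Z_k^j\oplus\{B_iv_k^j\}\oplus\overline{\mathsf W}\subseteq\mathsf Z_{k+1}^j$ for all $i$, $\mathsf Z_k^j\subseteq\mathbb Z$, $\{v_k^j\}\oplus K_f\mathsf Z_k^j\subseteq\mathbb V$; and $\mathsf Z_{N_p}^j\subseteq\mathbb Z_f$. One minimizes $$\sum_{k<N_r}\sum_j\omega_k^j\,\ell(z_k^j,v_k^j)+\sum_{k=N_r}^{N_p-1}\sum_{j=1}^{n_d^{N_r}} n_d^{k-N_r}\omega_{\mathrm{tube}}\max_{\tilde z\in\mathsf Z_k^j}\ell(\tilde z,v_k^j+K_f\tilde z)+\sum_{j=1}^{n_d^{N_r}}\max_{\tilde z\in\mathsf Z_{N_p}^j}V_f(\tilde z),$$ where $\omega_0^1$ is the root weight and every other $\omega_k^j$ is the weight $\omega_{i,l}$ of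 the realization from which the node results. Let $\mathtt X_{N_p}$ be the set of $x\in\mathbb X$ at which the problem is feasible. The first predicted input $v_0$ is the input at the root (for $N_r=0$: the feed-forward term at stage $0$ plus $K_fz_0$). **Assumptions.** 1. $0<\omega_0^1\le\omega_{i,l}\le\omega_{\mathrm{tube}}$ for all $i,l$. 2. $\mathsf S$ is a polytope with $(A_i+B_iK_{\mathrm{inv}})\mathsf S\oplus\underline{\mathsf W}\subseteq\mathsf S$ for all $i$, $\mathsf S\subseteq\mathbb X$, $K_{\mathrm{inv}}\mathsf S\subseteq\mathbb U$; and $\mathsf S=\{0\}$ if $\underline{\mathsf W}=\{0\}$. 3. $\mathbb Z_f\ni0$ is a polytope, RPI for $\{(A_i,B_i)\}_i,K_f,\overline{\mathsf W}$, with $\mathbb Z_f\subseteq\mathbb Z$, $K_f\mathbb Z_f\subseteq\mathbb V$; and for every $Z\in\mathcal T$ with $Z\subseteq\mathbb Z_f$ there is $Z^+\in\mathcal T$ with $(A_i+B_iK_f)Z\oplus\overline{\mathsf W}\subseteq Z^+\subseteq\mathbb Z_f$ for all $i$. 4. $\ell:\mathbb R^n\times\mathbb R^m\to\mathbb R$ and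 $V_f:\mathbb R^n\to\mathbb R$ are convex and nonnegative; $\ell(z,K_fz)=V_f(z)=0$ for $z\in\mathbb Z_f$; and for some $c>0$ and $p\in[1,\infty]$, $\ell(z,v)\ge c\min_{y\in\mathbb Z_f}\|z-y\|_p$ for all $z\in\mathbb Z\setminus\mathbb Z_f$ and all $v$. 5. $K_f$ is stabilizing; $\mathbb X_{\max}\subseteq\mathbb X$ is RPI for $\mathcal M,K_f,\mathsf W$; $\mathbb Z_f\oplus\mathsf S$ is contained in the interior of $\mathbb X_{\max}$ relative to $\mathbb X$; and $\kappa$ is a dual-mode control policy: $\kappa(x)=K_fx$ if $x\in\mathbb X_{\max}$, and for every $x\in\mathtt X_{N_p}\setminus\mathbb X_{\max}$, $\kappa(x)=v_0+K_{\mathrm{inv}}(x-z_0)$, where $z_0$ and $v_0$ are the root and the first predicted input of an optimal solution at $x$. Let $\mathsf S_{\min}$ be the minimal RPI set for $\{(A_i,B_i)\}_i,K_f,\mathsf W$, i.e. the nonempty closed RPI set that is contained in every nonempty closed RPI set. **Corollary.** Under Assumptions 1–5, if $\mathsf S_{\min}$ is contained in the interior of $\mathbb Z_f\oplus\mathsf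 S$, then the dual-mode closed loop reaches $\mathbb Z_f\oplus\mathsf S$ in finitely many steps: for every $x_0\in\mathtt X_{N_p}\cup\mathbb X_{\max}$ there is $N\in\mathbb N$ such that every trajectory $x_{t+1}=A_tx_t+B_t\kappa(x_t)+w_t$ starting at $x_0$, with arbitrary $(A_t,B_t)\in\mathcal M$ and $w_t\in\mathsf W$, satisfies $x_t\in\mathbb Z_f\oplus\mathsf S$ for some $t\le N$. -/

import Mathlib

open scoped Pointwise Topology ENNReal

/-- Column vectors of length `k`. -/
abbrev Vec (k : ℕ) : Type := Fin k → ℝ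

/-- A pair (system matrix, input matrix). -/
abbrev SysPair (n m : ℕ) : Type := Matrix (Fin n) (Fin n) ℝ × Matrix (Fin n) (Fin m) ℝ

/-- A (nonempty, bounded) polytope: the convex hull of finitely many points. -/
def IsPolytope {k : ℕ} (s : Set (Vec k)) : Prop :=
  ∃ F : Finset (Vec k), F.Nonempty ∧ s = convexHull ℝ (F : Set (Vec k))

/-- Pontryagin difference `s ⊖ t`. -/
def pontryaginDiff {k : ℕ} (s t : Set (Vec k)) : Set (Vec k) :=
  {z | ∀ y ∈ t, z + y ∈ s}

/-- The linear image `K s` of a set. -/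
def gainImage {n m : ℕ} (K : Matrix (Fin m) (Fin n) ℝ) (s : Set (Vec n)) : Set (Vec m) :=
  (fun x => K.mulVec x) '' s

/-- `T` is robust positively invariant for `x⁺ = (A + B K) x + w`, where `(A, B)` ranges over `M`
and `w` over `W`. -/
def IsRPI {n m : ℕ} (M : Set (SysPair n m)) (K : Matrix (Fin m) (Fin n) ℝ)
    (W T : Set (Vec n)) : Prop :=
  ∀ x ∈ T, ∀ q ∈ M, ∀ w ∈ W, (q.1 + q.2 * K).mulVec x + w ∈ T

/-- `T` is the minimal robust positively invariant set: a (nonempty, closed) RPI set that is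
contained in every (nonempty) closed RPI set. -/
structure IsMinimalRPI {n m : ℕ} (M : Set (SysPair n m)) (K : Matrix (Fin m) (Fin n) ℝ)
    (W T : Set (Vec n)) : Prop where
  nonempty : T.Nonempty
  isClosed : IsClosed T
  rpi : IsRPI M K W T
  minimal : ∀ T' : Set (Vec n), T'.Nonempty → IsClosed T' → IsRPI M K W T' → T ⊆ T'

/-- The gain `K` is asymptotically stabilizing for the parameter-varying system
`x⁺ = (A + B K) x`, where `(A, B) ∈ M` may change at every step.  For a linear
system this is uniform exponential stability, i.e. joint spectral radius smaller than one. -/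
def IsStabilizing {n m : ℕ} (M : Set (SysPair n m)) (K : Matrix (Fin m) (Fin n) ℝ) : Prop :=
  ∃ C ρ : ℝ, 0 ≤ ρ ∧ ρ < 1 ∧
    ∀ (q : ℕ → SysPair n m) (x : ℕ → Vec n), (∀ t, q t ∈ M) →
      (∀ t, x (t + 1) = ((q t).1 + (q t).2 * K).mulVec (x t)) →
      ∀ t, ‖x t‖ ≤ C * ρ ^ t * ‖x 0‖

/-- The distance `|z|_s = min_{y ∈ s} ‖z - y‖_p`. -/
noncomputable def setDist {k : ℕ} (p : ℝ≥0∞) (s : Set (Vec k)) (z : Vec k) : ℝ :=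
  sInf ((fun y => ‖WithLp.toLp p (z - y)‖) '' s)

/-- The data of a tube-enhanced multi-stage MPC problem with `np` vertex pairs `(A_i, B_i)` and
`nw` vertices of the large disturbance set; no assumption is made on the data here. -/
structure TubeMPC (n m np nw : ℕ) where
  /-- vertex system matrices -/
  A : Fin np → Matrix (Fin n) (Fin n) ℝ
  /-- vertex input matrices -/
  B : Fin np → Matrix (Fin n) (Fin m) ℝ
  /-- all additive disturbances -/
  W : Set (Vec n)
  /-- vertices of the set of large disturbances -/
  wbar : Fin nw → Vec n
  /-- small disturbances -/
  Wsmall : Set (Vec n)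
  /-- state constraint set -/
  X : Set (Vec n)
  /-- input constraint set -/
  U : Set (Vec m)
  /-- gain of the invariant tube -/
  Kinv : Matrix (Fin m) (Fin n) ℝ
  /-- common gain of the terminal controller and of the predicted tubes -/
  Kf : Matrix (Fin m) (Fin n) ℝ
  /-- invariant tube -/
  S : Set (Vec n)
  /-- terminal set -/
  Zf : Set (Vec n)
  /-- the class of sets that are employed as predicted tubes -/
  tubes : Set (Set (Vec n))
  /-- stage cost -/
  stageCost : Vec n → Vec m → ℝ
  /-- terminal penalty -/
  termCost : Vec n → ℝ
  /-- weight of the root node -/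
  weightRoot : ℝ
  /-- weights of the realizations of the uncertainty -/
  weight : Fin np × Fin nw → ℝ
  /-- base weight of the tubes -/
  weightTube : ℝ
  /-- robust horizon -/
  Nr : ℕ
  /-- prediction horizon -/
  Np : ℕ

namespace TubeMPC

variable {n m np nw : ℕ}

/-- The vertices `(A_i, B_i)`. -/
def vertexPairs (P : TubeMPC n m np nw) : Set (SysPair n m) :=
  Set.range fun i => (P.A i, P.B i)

/-- All admissible pairs, `conv {(A_i, B_i)}`. -/
def pairs (P : TubeMPC n m np nw) : Set (SysPair n m) :=
  convexHull ℝ P.vertexPairs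

/-- The set of large disturbances. -/
def Wbar (P : TubeMPC n m np nw) : Set (Vec n) :=
  convexHull ℝ (Set.range P.wbar)

/-- Tightened state constraint set `X ⊖ S`. -/
def Zset (P : TubeMPC n m np nw) : Set (Vec n) :=
  pontryaginDiff P.X P.S

/-- Tightened input constraint set `U ⊖ K_inv S`. -/
def Vset (P : TubeMPC n m np nw) : Set (Vec m) :=
  pontryaginDiff P.U (gainImage P.Kinv P.S)

/-- Nodes of the scenario tree at stage `k`: the sequences of the `k` realizations `(i, l)` that
lead to the node, the most recent one first.  The child of `j` for the realization `d` is
`Fin.cons d j`. -/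
abbrev Node (_P : TubeMPC n m np nw) (k : ℕ) : Type := Fin k → Fin np × Fin nw

/-- The weight of a node of the multi-stage part: the root weight at stage `0`, otherwise the weight
of the realization from which the node results. -/
def nodeWeight (P : TubeMPC n m np nw) : (k : ℕ) → P.Node k → ℝ
  | 0, _ => P.weightRoot
  | _ + 1, j => P.weight (j 0)

/-- The decision variables: states `z k j` and inputs `v k j` of the scenario tree (relevant up to
the robust horizon), and, for every node `j` at the robust horizon, tubes `Z k j` and feed-forward
terms `c k j` (relevant from the robust horizon on). -/
structure Plan (P : TubeMPC n m np nw) where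
  z : (k : ℕ) → P.Node k → Vec n
  v : (k : ℕ) → P.Node k → Vec m
  Z : ℕ → P.Node P.Nr → Set (Vec n)
  c : ℕ → P.Node P.Nr → Vec m

/-- The root node of the scenario tree. -/
def Plan.root {P : TubeMPC n m np nw} (q : P.Plan) : Vec n := q.z 0 Fin.elim0

/-- The first predicted input: the input of the root node or, if there is no multi-stage part, the
affine tube input at the root node. -/
def Plan.firstInput {P : TubeMPC n m np nw} (q : P.Plan) : Vec m :=
  if h : P.Nr = 0 then q.c 0 (fun i => (Fin.cast h i).elim0) + P.Kf.mulVec q.root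
  else q.v 0 Fin.elim0

/-- The constraints of the optimization problem at the measured state `x`. -/
structure Plan.Feasible {P : TubeMPC n m np nw} (q : P.Plan) (x : Vec n) : Prop where
  dynamics : ∀ k < P.Nr, ∀ j : P.Node k, ∀ d : Fin np × Fin nw,
    q.z (k + 1) (Fin.cons d j) =
      (P.A d.1).mulVec (q.z k j) + (P.B d.1).mulVec (q.v k j) + P.wbar d.2
  state_mem : ∀ k < P.Nr, ∀ j : P.Node k, q.z k j ∈ P.Zset
  input_mem : ∀ k < P.Nr, ∀ j : P.Node k, q.v k j ∈ P.Vset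
  tube_mem : ∀ k, P.Nr ≤ k → k ≤ P.Np → ∀ j, q.Z k j ∈ P.tubes
  tube_init : ∀ j, q.z P.Nr j ∈ q.Z P.Nr j ∧ q.Z P.Nr j ⊆ P.Zset
  tube_dynamics : ∀ k, P.Nr ≤ k → k < P.Np → ∀ j, ∀ i : Fin np,
    gainImage (P.A i + P.B i * P.Kf) (q.Z k j) + {(P.B i).mulVec (q.c k j)} + P.Wbar
      ⊆ q.Z (k + 1) j
  tube_state : ∀ k, P.Nr ≤ k → k < P.Np → ∀ j, q.Z k j ⊆ P.Zset
  tube_input : ∀ k, P.Nr ≤ k → k < P.Np → ∀ j,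
    {q.c k j} + gainImage P.Kf (q.Z k j) ⊆ P.Vset
  terminal : ∀ j, q.Z P.Np j ⊆ P.Zf
  initial : x ∈ ({q.root} : Set (Vec n)) + P.S

/-- The objective: the weighted stage costs of the scenario tree, the weighted worst-case stage costs
over the tubes (with weights `n_d ^ (k - N_r) * ω_tube`, `n_d = np * nw`), and the worst-case
terminal penalties.  The states in different tubes vary independently, so that the maximum of the
weighted sum over the tubes is the weighted sum of the maxima. -/
noncomputable def Plan.cost {P : TubeMPC n m np nw} (q : P.Plan) : ℝ :=
  (∑ k ∈ Finset.range P.Nr, ∑ j : P.Node k,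
      P.nodeWeight k j * P.stageCost (q.z k j) (q.v k j))
  + (∑ k ∈ Finset.Ico P.Nr P.Np, ∑ j : P.Node P.Nr,
      ((np * nw : ℕ) : ℝ) ^ (k - P.Nr) * P.weightTube *
        sSup ((fun y => P.stageCost y (q.c k j + P.Kf.mulVec y)) '' q.Z k j))
  + ∑ j : P.Node P.Nr, sSup (P.termCost '' q.Z P.Np j)

/-- `q` is an optimal solution of the optimization problem at the state `x`. -/
def Plan.IsOptimal {P : TubeMPC n m np nw} (q : P.Plan) (x : Vec n) : Prop :=
  q.Feasible x ∧ ∀ q' : P.Plan, q'.Feasible x → q.cost ≤ q'.cost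

/-- The feasible domain of the optimization problem. -/
def feasibleSet (P : TubeMPC n m np nw) : Set (Vec n) :=
  {x | x ∈ P.X ∧ ∃ q : P.Plan, q.Feasible x}

/-- Standing conventions of the set-up: polytopic disturbance and constraint sets, the decomposition
of the disturbance set (the small part may be `{0}`), horizons `0 ≤ N_r ≤ N_p`, `1 ≤ N_p`, a
stabilizing gain of the invariant tube; the tubes are nonempty compact convex sets, and convex
combinations of tubes are tubes. -/
structure Standing (P : TubeMPC n m np nw) : Prop where
  np_pos : 0 < np
  nw_pos : 0 < nw
  W_polytope : IsPolytope P.W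
  zero_mem_W : (0 : Vec n) ∈ interior P.W
  zero_mem_Wbar : (0 : Vec n) ∈ P.Wbar
  Wsmall_polytope : IsPolytope P.Wsmall
  zero_mem_Wsmall : (0 : Vec n) ∈ P.Wsmall
  W_subset : P.W ⊆ P.Wbar + P.Wsmall
  X_polytope : IsPolytope P.X
  U_polytope : IsPolytope P.U
  Np_pos : 1 ≤ P.Np
  Nr_le : P.Nr ≤ P.Np
  Kinv_stabilizing : IsStabilizing P.pairs P.Kinv
  tube_nonempty : ∀ Z ∈ P.tubes, Z.Nonempty
  tube_compact : ∀ Z ∈ P.tubes, IsCompact Z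
  tube_convex : ∀ Z ∈ P.tubes, Convex ℝ Z
  tube_comb : ∀ Z₁ ∈ P.tubes, ∀ Z₂ ∈ P.tubes, ∀ a b : ℝ, 0 ≤ a → 0 ≤ b → a + b = 1 →
    a • Z₁ + b • Z₂ ∈ P.tubes

/-- Assumption on the weights. -/
structure WeightAssumption (P : TubeMPC n m np nw) : Prop where
  root_pos : 0 < P.weightRoot
  root_le : ∀ d, P.weightRoot ≤ P.weight d
  le_tube : ∀ d, P.weight d ≤ P.weightTube

/-- Assumption on the invariant tube: `S` is a polytope with
`(A_i + B_i K_inv) S ⊕ W_small ⊆ S` for all `i`, compatible with the constraints. -/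
structure InvariantTubeAssumption (P : TubeMPC n m np nw) : Prop where
  polytope : IsPolytope P.S
  invariant : IsRPI P.vertexPairs P.Kinv P.Wsmall P.S
  subset_X : P.S ⊆ P.X
  gain_subset_U : gainImage P.Kinv P.S ⊆ P.U
  trivial_tube : P.Wsmall = {0} → P.S = {0}

/-- Assumption on the terminal set: an RPI polytope for the large disturbances that respects the
tightened constraints, and every tube in it has a successor tube in it. -/
structure TerminalAssumption (P : TubeMPC n m np nw) : Prop where
  polytope : IsPolytope P.Zf
  zero_mem : (0 : Vec n) ∈ P.Zf
  subset_Z : P.Zf ⊆ P.Zset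
  gain_subset_V : gainImage P.Kf P.Zf ⊆ P.Vset
  rpi : IsRPI P.vertexPairs P.Kf P.Wbar P.Zf
  tube_succ : ∀ Z ∈ P.tubes, Z ⊆ P.Zf → ∃ Z' ∈ P.tubes,
    (∀ i, gainImage (P.A i + P.B i * P.Kf) Z + P.Wbar ⊆ Z') ∧ Z' ⊆ P.Zf

/-- Assumption on the costs; `|·|_{Z_f}` is measured in the `p`-norm. -/
structure CostAssumption (P : TubeMPC n m np nw) (p : ℝ≥0∞) : Prop where
  stage_convex : ConvexOn ℝ Set.univ fun y : Vec n × Vec m => P.stageCost y.1 y.2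
  stage_nonneg : ∀ z v, 0 ≤ P.stageCost z v
  term_convex : ConvexOn ℝ Set.univ P.termCost
  term_nonneg : ∀ z, 0 ≤ P.termCost z
  stage_lower : ∃ c > 0, ∀ z ∈ P.Zset \ P.Zf, ∀ v, c * setDist p P.Zf z ≤ P.stageCost z v
  stage_zero : ∀ z ∈ P.Zf, P.stageCost z (P.Kf.mulVec z) = 0
  term_zero : ∀ z ∈ P.Zf, P.termCost z = 0

/-- Assumption on the dual mode control policy `κ`: on the RPI set `Xmax` it is the asymptotically
stabilizing feedback `K_f x`; at every other feasible state it is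
`v + K_inv (x - z)` for an optimal solution of the optimization problem.  The set `Z_f ⊕ S` lies in
the interior of `Xmax` relative to the state constraint set. -/
structure DualModeAssumption (P : TubeMPC n m np nw) (Xmax : Set (Vec n))
    (κ : Vec n → Vec m) : Prop where
  stabilizing : IsStabilizing P.pairs P.Kf
  rpi : IsRPI P.pairs P.Kf P.W Xmax
  subset_X : Xmax ⊆ P.X
  terminal_subset : P.Zf + P.S ⊆ Xmax
  terminal_inside : ∀ x ∈ P.Zf + P.S, Xmax ∈ 𝓝[P.X] x
  inner : ∀ x ∈ Xmax, κ x = P.Kf.mulVec x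
  outer : ∀ x ∈ P.feasibleSet \ Xmax, ∃ q : P.Plan, q.IsOptimal x ∧
    κ x = q.firstInput + P.Kinv.mulVec (x - q.root)

/-- `x` is a trajectory of the uncertain system `x⁺ = A x + B u + w` in closed loop with `u = κ x`;
the pair `(A, B)` and the disturbance may change arbitrarily at every step. -/
structure IsTrajectory (P : TubeMPC n m np nw) (κ : Vec n → Vec m)
    (q : ℕ → SysPair n m) (w : ℕ → Vec n) (x : ℕ → Vec n) : Prop where
  pair_mem : ∀ t, q t ∈ P.pairs
  dist_mem : ∀ t, w t ∈ P.W
  step : ∀ t, x (t + 1) = (q t).1.mulVec (x t) + (q t).2.mulVec (κ (x t)) + w t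

end TubeMPC

/-! The argument has two phases. Outside `Xmax` the cost acts as a Lyapunov function. The actual
pair `(A, B)` and the large part of the disturbance determine convex weights on the vertex
realizations. The same convex combination of the subtrees below the root, prolonged by one tube
inside `Zf`, is feasible at the successor state, while `S` absorbs the small part of the disturbance
(`Plan.Feasible.exists_successor`). Jensen's inequality and the ordering of the weights make this
candidate cheaper by at least the weighted stage cost of the root (`Plan.cost_shift_le`). That stage
cost has a positive lower bound outside `Xmax`, because the compact set `Zf + S` has a uniform
margin in `Xmax` relative to `X` (`exists_stageCost_lower`). As costs are nonnegative, the cost of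
one feasible plan at `x₀` bounds the time to reach `Xmax`.

Inside `Xmax` the loop is linear. Its distance to a reference trajectory started in `Smin`, with the
same pairs and disturbances, decays exponentially; the reference stays in the convex hull of `Smin`,
which has a positive margin inside `Zf + S` (`IsStabilizing.exists_uniform_entry`). -/

/-! ### Convex hulls, polytopes and robust invariance -/

/-- A point of the convex hull of a finite family is a convex combination of that family. -/
lemma exists_weights_of_mem_convexHull_range {ι E : Type*} [Fintype ι] [AddCommGroup E]
    [Module ℝ E] (f : ι → E) {x : E} (hx : x ∈ convexHull ℝ (Set.range f)) :
    ∃ w : ι → ℝ, (∀ i, 0 ≤ w i) ∧ ∑ i, w i = 1 ∧ ∑ i, w i • f i = x := by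
  classical
  let T : Set E := {x | ∃ w : ι → ℝ, (∀ i, 0 ≤ w i) ∧ ∑ i, w i = 1 ∧ ∑ i, w i • f i = x}
  have hT : Convex ℝ T := by
    rintro _ ⟨u, hu0, hu1, rfl⟩ _ ⟨v, hv0, hv1, rfl⟩ a b ha hb hab
    refine ⟨fun i => a * u i + b * v i, fun i => ?_, ?_, ?_⟩
    · have := hu0 i
      have := hv0 i
      positivity
    · rw [Finset.sum_add_distrib, ← Finset.mul_sum, ← Finset.mul_sum, hu1, hv1]
      linarith
    · simp only [add_smul, mul_smul, Finset.sum_add_distrib, Finset.smul_sum]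
  refine convexHull_min (t := T) ?_ hT hx
  rintro _ ⟨i, rfl⟩
  refine ⟨Pi.single i 1, fun j => ?_, by simp, ?_⟩
  · by_cases h : j = i
    · subst h; simp
    · simp [h]
  · simp [Pi.single_apply, ite_smul]

lemma IsPolytope.isCompact {k : ℕ} {s : Set (Vec k)} (h : IsPolytope s) : IsCompact s := by
  obtain ⟨F, -, rfl⟩ := h
  exact F.finite_toSet.isCompact_convexHull ℝ

lemma IsPolytope.convex {k : ℕ} {s : Set (Vec k)} (h : IsPolytope s) : Convex ℝ s := by
  obtain ⟨F, -, rfl⟩ := h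
  exact convex_convexHull ℝ _

lemma IsPolytope.nonempty {k : ℕ} {s : Set (Vec k)} (h : IsPolytope s) : s.Nonempty := by
  obtain ⟨F, hF, rfl⟩ := h
  exact (Finset.coe_nonempty.2 hF).convexHull

lemma Convex.pontryaginDiff {k : ℕ} {s : Set (Vec k)} (hs : Convex ℝ s) (t : Set (Vec k)) :
    Convex ℝ (pontryaginDiff s t) := by
  intro x hx z hz a b ha hb hab y hy
  have := hs (hx y hy) (hz y hy) ha hb hab
  convert this using 1
  rw [smul_add, smul_add, add_add_add_comm, ← add_smul, hab, one_smul]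

/-- An RPI set that is convex is invariant for the convex hull of the admissible pairs. -/
lemma IsRPI.convexHull_pairs {n m : ℕ} {M : Set (SysPair n m)} {K : Matrix (Fin m) (Fin n) ℝ}
    {W T : Set (Vec n)} (h : IsRPI M K W T) (hT : Convex ℝ T) :
    IsRPI (convexHull ℝ M) K W T := by
  intro x hx q hq w hw
  refine convexHull_min (t := {q : SysPair n m | (q.1 + q.2 * K).mulVec x + w ∈ T})
    (fun q hq => h x hx q hq w hw) ?_ hq
  intro q₁ h₁ q₂ h₂ a b ha hb hab
  have := hT h₁ h₂ ha hb hab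
  change ((a • q₁ + b • q₂).1 + (a • q₁ + b • q₂).2 * K).mulVec x + w ∈ T
  convert this using 1
  have hw : w = a • w + b • w := by rw [← add_smul, hab, one_smul]
  simp only [Prod.fst_add, Prod.snd_add, Prod.smul_fst, Prod.smul_snd, Matrix.add_mul,
    Matrix.smul_mul, Matrix.add_mulVec, Matrix.smul_mulVec, smul_add]
  nth_rewrite 1 [hw]
  abel

/-- The convex hull of an RPI set is RPI. -/
lemma IsRPI.convexHull_set {n m : ℕ} {M : Set (SysPair n m)} {K : Matrix (Fin m) (Fin n) ℝ}
    {W T : Set (Vec n)} (h : IsRPI M K W T) : IsRPI M K W (convexHull ℝ T) := by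
  intro x hx q hq w hw
  refine convexHull_min (t := {x : Vec n | (q.1 + q.2 * K).mulVec x + w ∈ convexHull ℝ T})
    (fun x hx => subset_convexHull ℝ T (h x hx q hq w hw)) ?_ hx
  intro x₁ h₁ x₂ h₂ a b ha hb hab
  have := convex_convexHull ℝ T h₁ h₂ ha hb hab
  change (q.1 + q.2 * K).mulVec (a • x₁ + b • x₂) + w ∈ convexHull ℝ T
  convert this using 1
  have hw : w = a • w + b • w := by rw [← add_smul, hab, one_smul]
  simp only [Matrix.mulVec_add, Matrix.mulVec_smul, smul_add]
  nth_rewrite 1 [hw]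
  abel

/-- A uniform margin around a compact subset of an open convex set persists for its convex hull. -/
lemma exists_margin_convexHull {E : Type*} [NormedAddCommGroup E] [NormedSpace ℝ E]
    {T O : Set E} (hT : IsCompact T) (hO : IsOpen O) (hc : Convex ℝ O) (hTO : T ⊆ O) :
    ∃ δ > 0, ∀ y ∈ convexHull ℝ T, ∀ e, ‖e‖ < δ → y + e ∈ O := by
  obtain ⟨δ, hδ, hsub⟩ := hT.exists_thickening_subset_open hO hTO
  refine ⟨δ, hδ, fun y hy => ?_⟩
  refine convexHull_min (t := {y : E | ∀ e, ‖e‖ < δ → y + e ∈ O}) ?_ ?_ hy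
  · intro y hy e he
    refine hsub (Metric.mem_thickening_iff.2 ⟨y, hy, ?_⟩)
    simpa [dist_eq_norm] using he
  · intro y₁ h₁ y₂ h₂ a b ha hb hab e he
    have := hc (h₁ e he) (h₂ e he) ha hb hab
    convert this using 1
    rw [smul_add, smul_add, add_add_add_comm, ← add_smul, hab, one_smul]

/-! ### Uniform entry, margins and distances -/

/-- Under a stabilizing gain, all trajectories from a bounded set reach, after a uniform number of
steps, a convex neighbourhood of an RPI set of the vertex system. -/
lemma IsStabilizing.exists_uniform_entry {n m : ℕ} {M : Set (SysPair n m)}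
    {K : Matrix (Fin m) (Fin n) ℝ} (hK : IsStabilizing (convexHull ℝ M) K)
    {W T G D : Set (Vec n)} (hT0 : T.Nonempty) (hTc : IsCompact T) (hT : IsRPI M K W T)
    (hG : Convex ℝ G) (hTG : T ⊆ interior G) (hD : Bornology.IsBounded D) :
    ∃ N : ℕ, ∀ (q : ℕ → SysPair n m) (w x : ℕ → Vec n), (∀ t, q t ∈ convexHull ℝ M) →
      (∀ t, w t ∈ W) → (∀ t, x (t + 1) = ((q t).1 + (q t).2 * K).mulVec (x t) + w t) →
      x 0 ∈ D → x N ∈ G := by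
  obtain ⟨δ, hδ, hmargin⟩ := exists_margin_convexHull hTc isOpen_interior hG.interior hTG
  obtain ⟨C, ρ, hρ0, hρ1, hstab⟩ := hK
  obtain ⟨y₀, hy₀⟩ := hT0
  obtain ⟨R, hR⟩ := hD.exists_norm_le
  have hlim : Filter.Tendsto (fun t : ℕ => |C| * ρ ^ t * (|R| + ‖y₀‖)) Filter.atTop (𝓝 0) := by
    simpa using ((tendsto_pow_atTop_nhds_zero_of_lt_one hρ0 hρ1).const_mul |C|).mul_const
      (|R| + ‖y₀‖)
  obtain ⟨N, hN⟩ := (hlim.eventually (gt_mem_nhds hδ)).exists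
  refine ⟨N, fun q w x hq hw hx hx0 => ?_⟩
  -- The reference trajectory sees the same pairs and disturbances as `x`, so `x - y` obeys the
  -- disturbance-free system. It is only kept in the hull of `T`, since `T` is invariant for the
  -- vertex pairs alone and need not be convex.
  let y : ℕ → Vec n := fun t =>
    Nat.rec y₀ (fun t z => ((q t).1 + (q t).2 * K).mulVec z + w t) t
  have hy : ∀ t, y (t + 1) = ((q t).1 + (q t).2 * K).mulVec (y t) + w t := fun _ => rfl
  have hyT : ∀ t, y t ∈ convexHull ℝ T := by
    intro t
    induction t with
    | zero => exact subset_convexHull ℝ T hy₀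
    | succ t ih =>
      rw [hy]
      exact hT.convexHull_set.convexHull_pairs (convex_convexHull ℝ T) _ ih _ (hq t) _ (hw t)
  have hdiff := hstab q (fun t => x t - y t) hq (fun t => by
    simp only [hx, hy, Matrix.mulVec_sub]; abel) N
  have hbound : ‖x N - y N‖ < δ := by
    refine lt_of_le_of_lt (hdiff.trans ?_) hN
    have h0 : ‖x 0 - y 0‖ ≤ |R| + ‖y₀‖ :=
      (norm_sub_le _ _).trans (add_le_add ((hR _ hx0).trans (le_abs_self R)) le_rfl)
    have hρN : 0 ≤ ρ ^ N := pow_nonneg hρ0 N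
    exact mul_le_mul (mul_le_mul_of_nonneg_right (le_abs_self C) hρN) h0 (norm_nonneg _)
      (by positivity)
  have := hmargin (y N) (hyT N) _ hbound
  rw [add_sub_cancel] at this
  exact interior_subset this

/-- Points of `X` close to a compact set `G` lie in any neighbourhood of `G` relative to `X`. -/
lemma exists_uniform_relative_margin {E : Type*} [NormedAddCommGroup E] {X G D : Set E}
    (hG : IsCompact G) (h : ∀ x ∈ G, D ∈ 𝓝[X] x) :
    ∃ δ > 0, ∀ x ∈ X, ∀ y ∈ G, ‖x - y‖ < δ → x ∈ D := by
  -- The implication turns a neighbourhood relative to `X` into a neighbourhood in the whole space.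
  have hsub : G ⊆ interior {x | x ∈ X → x ∈ D} := fun y hy =>
    mem_interior_iff_mem_nhds.2 (mem_nhdsWithin_iff_eventually.1 (h y hy))
  obtain ⟨δ, hδ, hth⟩ := hG.exists_thickening_subset_open isOpen_interior hsub
  refine ⟨δ, hδ, fun x hx y hy hxy => ?_⟩
  have : x ∈ Metric.thickening δ G := Metric.mem_thickening_iff.2 ⟨y, hy, by rwa [dist_eq_norm]⟩
  exact interior_subset (hth this) hx

/-- The distance to a set is bounded below by a lower bound for the sup norm. -/
lemma le_setDist {k : ℕ} {p : ℝ≥0∞} (hp : 1 ≤ p) {s : Set (Vec k)} (hs : s.Nonempty) {z : Vec k}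
    {δ : ℝ} (h : ∀ y ∈ s, δ ≤ ‖z - y‖) : δ ≤ setDist p s z := by
  have : Fact (1 ≤ p) := ⟨hp⟩
  refine le_csInf (hs.image _) ?_
  rintro _ ⟨y, hy, rfl⟩
  refine (h y hy).trans ((pi_norm_le_iff_of_nonneg (norm_nonneg _)).2 fun i => ?_)
  exact PiLp.norm_apply_le (WithLp.toLp p (z - y)) i

/-! ### Convex combinations of sets -/

/-- Finite convex combinations of tubes are tubes. -/
lemma sum_smul_mem_of_convexComb {E ι : Type*} [AddCommGroup E] [Module ℝ E] {𝒯 : Set (Set E)}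
    (hne : ∀ Z ∈ 𝒯, Z.Nonempty)
    (hcomb : ∀ Z₁ ∈ 𝒯, ∀ Z₂ ∈ 𝒯, ∀ a b : ℝ, 0 ≤ a → 0 ≤ b → a + b = 1 →
      a • Z₁ + b • Z₂ ∈ 𝒯)
    (Z : ι → Set E) (s : Finset ι) :
    ∀ w : ι → ℝ, (∀ i ∈ s, Z i ∈ 𝒯) → (∀ i ∈ s, 0 ≤ w i) → ∑ i ∈ s, w i = 1 →
      ∑ i ∈ s, w i • Z i ∈ 𝒯 := by
  classical
  induction s using Finset.induction_on with
  | empty => intro w _ _ h; simp at h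
  | insert a s ha ih =>
    intro w hZ hw h1
    have hZa := hZ a (Finset.mem_insert_self a s)
    have hZs : ∀ i ∈ s, Z i ∈ 𝒯 := fun i hi => hZ i (Finset.mem_insert_of_mem hi)
    have hws : ∀ i ∈ s, 0 ≤ w i := fun i hi => hw i (Finset.mem_insert_of_mem hi)
    rw [Finset.sum_insert ha] at h1 ⊢
    -- If the remaining weights vanish, nonemptiness gives `0 • Z i = {0}`; otherwise they are
    -- renormalized to sum to one.
    by_cases h0 : ∑ i ∈ s, w i = 0
    · have hzero : ∑ i ∈ s, w i • Z i = 0 := by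
        refine Finset.sum_eq_zero fun i hi => ?_
        rw [(Finset.sum_eq_zero_iff_of_nonneg hws).1 h0 i hi, Set.zero_smul_set (hne _ (hZs i hi))]
      have hwa : w a = 1 := by linarith
      rw [hzero, hwa, one_smul, add_zero]
      exact hZa
    · have hpos : 0 < ∑ i ∈ s, w i :=
        lt_of_le_of_ne (Finset.sum_nonneg hws) (Ne.symm h0)
      have hih := ih (fun i => (∑ i ∈ s, w i)⁻¹ * w i) hZs
        (fun i hi => mul_nonneg (inv_nonneg.2 hpos.le) (hws i hi))
        (by rw [← Finset.mul_sum, inv_mul_cancel₀ h0])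
      have := hcomb _ hZa _ hih (w a) (∑ i ∈ s, w i) (hw a (Finset.mem_insert_self a s)) hpos.le h1
      convert this using 2
      rw [Finset.smul_sum]
      refine Finset.sum_congr rfl fun i _ => ?_
      rw [smul_smul, mul_inv_cancel_left₀ h0]

/-- A convex combination of subsets of a convex set is contained in it. -/
lemma Convex.sum_smul_subset {E ι : Type*} [AddCommGroup E] [Module ℝ E] [Fintype ι] {C : Set E}
    (hC : Convex ℝ C) {Z : ι → Set E} (hZ : ∀ i, Z i ⊆ C) {w : ι → ℝ} (hw : ∀ i, 0 ≤ w i)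
    (h1 : ∑ i, w i = 1) : ∑ i, w i • Z i ⊆ C := by
  intro y hy
  obtain ⟨g, hg, rfl⟩ := (Set.mem_fintype_sum _ _).1 hy
  choose f hf hfg using fun i => Set.mem_smul_set.1 (hg i)
  rw [← Finset.sum_congr rfl fun i _ => hfg i]
  exact hC.sum_mem (fun i _ => hw i) h1 fun i _ => hZ i (hf i)

lemma mem_sum_smul_iff {E ι : Type*} [AddCommGroup E] [Module ℝ E] [Fintype ι]
    {Z : ι → Set E} {w : ι → ℝ} {y : E} :
    y ∈ ∑ i, w i • Z i ↔ ∃ f : ι → E, (∀ i, f i ∈ Z i) ∧ ∑ i, w i • f i = y := by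
  constructor
  · intro hy
    obtain ⟨g, hg, rfl⟩ := (Set.mem_fintype_sum _ _).1 hy
    choose f hf hfg using fun i => Set.mem_smul_set.1 (hg i)
    exact ⟨f, hf, Finset.sum_congr rfl fun i _ => hfg i⟩
  · rintro ⟨f, hf, rfl⟩
    exact (Set.mem_fintype_sum _ _).2 ⟨_, fun i => Set.smul_mem_smul_set (hf i), rfl⟩

/-! ### Scenario-tree nodes and extension of plans -/

namespace TubeMPC

variable {n m np nw : ℕ}

/-- The node that is reached by the realization `d` followed by the realizations of `j`. -/
def prepend (P : TubeMPC n m np nw) {k : ℕ} (d : Fin np × Fin nw) (j : P.Node k) :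
    P.Node (k + 1) :=
  -- Nodes list the most recent realization first, so the earliest one goes last.
  Fin.snoc (α := fun _ => Fin np × Fin nw) j d

/-- The node that is reached by `d` followed by the realizations of `j` except the last one. -/
def shiftNode (P : TubeMPC n m np nw) {k : ℕ} (d : Fin np × Fin nw) (j : P.Node k) : P.Node k :=
  Fin.tail (P.prepend d j)

/-- Past and future ends of a node are independent; this carries the tree dynamics over to the
candidate plan. -/
lemma prepend_cons (P : TubeMPC n m np nw) {k : ℕ} (d e : Fin np × Fin nw) (j : P.Node k) :
    P.prepend d (Fin.cons e j) = Fin.cons e (P.prepend d j) :=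
  (Fin.cons_snoc_eq_snoc_cons e j d).symm

/-- The input at a node of the scenario tree up to the robust horizon, where it is the input of the
tube. -/
noncomputable def Plan.input {P : TubeMPC n m np nw} (q : P.Plan) (k : ℕ) (j : P.Node k) : Vec m :=
  if h : k = P.Nr then q.c k (fun i => j (Fin.cast h.symm i)) + P.Kf.mulVec (q.z k j) else q.v k j

lemma Plan.input_of_lt {P : TubeMPC n m np nw} (q : P.Plan) {k : ℕ} (h : k < P.Nr)
    (j : P.Node k) : q.input k j = q.v k j := by
  rw [input, dif_neg h.ne]

lemma Plan.input_Nr {P : TubeMPC n m np nw} (q : P.Plan) (j : P.Node P.Nr) :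
    q.input P.Nr j = q.c P.Nr j + P.Kf.mulVec (q.z P.Nr j) := by
  rw [input, dif_pos rfl]
  rfl

/-- Treats `Nr = 0` and `Nr > 0` uniformly. -/
lemma Plan.firstInput_eq {P : TubeMPC n m np nw} (q : P.Plan) :
    q.firstInput = q.input 0 Fin.elim0 := by
  by_cases h : P.Nr = 0
  · rw [firstInput, input, dif_pos h, dif_pos h.symm]
    congr 2
  · rw [firstInput, input, dif_neg h, dif_neg (Ne.symm h)]

/-- The state at a node, predicted from its parent. -/
noncomputable def Plan.predicted {P : TubeMPC n m np nw} (q : P.Plan) (k : ℕ)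
    (j : P.Node (k + 1)) : Vec n :=
  (P.A (j 0).1).mulVec (q.z k (Fin.tail j)) + (P.B (j 0).1).mulVec (q.input k (Fin.tail j))
    + P.wbar (j 0).2

lemma Plan.Feasible.predicted_eq {P : TubeMPC n m np nw} {q : P.Plan} {x : Vec n}
    (h : q.Feasible x) {k : ℕ} (hk : k < P.Nr) (j : P.Node (k + 1)) :
    q.predicted k j = q.z (k + 1) j := by
  have := h.dynamics k hk (Fin.tail j) (j 0)
  rw [Fin.cons_self_tail] at this
  rw [this, predicted, q.input_of_lt hk]

/-- The plan comprises a further tube stage within the terminal set, with vanishing feed-forward. -/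
structure Plan.Extended {P : TubeMPC n m np nw} (q : P.Plan) : Prop where
  tube_mem : ∀ j, q.Z (P.Np + 1) j ∈ P.tubes
  tube_dynamics : ∀ j, ∀ i : Fin np,
    gainImage (P.A i + P.B i * P.Kf) (q.Z P.Np j) + P.Wbar ⊆ q.Z (P.Np + 1) j
  terminal : ∀ j, q.Z (P.Np + 1) j ⊆ P.Zf
  c_eq : ∀ j, q.c P.Np j = 0

/-- Every feasible plan can be extended by a tube stage without changing its cost. -/
lemma Plan.Feasible.exists_extended {P : TubeMPC n m np nw} (hs : P.Standing)
    (ht : P.TerminalAssumption) {q : P.Plan} {x : Vec n} (h : q.Feasible x) :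
    ∃ q' : P.Plan, q'.Feasible x ∧ q'.Extended ∧ q'.cost = q.cost ∧ q'.root = q.root ∧
      q'.firstInput = q.firstInput := by
  choose S hS hSd hSt using fun j =>
    ht.tube_succ (q.Z P.Np j) (h.tube_mem P.Np hs.Nr_le le_rfl j) (h.terminal j)
  -- Only data that neither the constraints nor the cost read are overwritten: tubes at stage `Np +
  -- 1` and feed-forward terms from stage `Np` on.
  let q' : P.Plan :=
    { z := q.z
      v := q.v
      Z := fun k j => if k = P.Np + 1 then S j else q.Z k j
      c := fun k j => if k < P.Np then q.c k j else 0 }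
  have hZ : ∀ k, k ≤ P.Np → ∀ j, q'.Z k j = q.Z k j := fun k hk j =>
    if_neg (show ¬ k = P.Np + 1 by omega)
  have hZs : ∀ j, q'.Z (P.Np + 1) j = S j := fun j => if_pos rfl
  have hc : ∀ k, k < P.Np → ∀ j, q'.c k j = q.c k j := fun k hk j => if_pos hk
  have hcN : ∀ j, q'.c P.Np j = 0 := fun j => if_neg (lt_irrefl _)
  refine ⟨q', ⟨h.dynamics, h.state_mem, h.input_mem, ?_, ?_, ?_, ?_, ?_, ?_, h.initial⟩,
    ⟨?_, ?_, ?_, hcN⟩, ?_, rfl, ?_⟩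
  · intro k hk hk' j
    rw [hZ k hk']
    exact h.tube_mem k hk hk' j
  · intro j
    rw [hZ _ hs.Nr_le]
    exact h.tube_init j
  · intro k hk hk' j i
    rw [hZ k hk'.le, hZ (k + 1) hk', hc k hk']
    exact h.tube_dynamics k hk hk' j i
  · intro k hk hk' j
    rw [hZ k hk'.le]
    exact h.tube_state k hk hk' j
  · intro k hk hk' j
    rw [hZ k hk'.le, hc k hk']
    exact h.tube_input k hk hk' j
  · intro j
    rw [hZ _ le_rfl]
    exact h.terminal j
  · intro j
    rw [hZs]
    exact hS j
  · intro j i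
    rw [hZs, hZ _ le_rfl]
    exact hSd j i
  · intro j
    rw [hZs]
    exact hSt j
  · unfold cost
    congr 1
    · congr 1
      refine Finset.sum_congr rfl fun k hk => Finset.sum_congr rfl fun j _ => ?_
      have hk := (Finset.mem_Ico.1 hk).2
      rw [hZ k hk.le, hc k hk]
    · exact Finset.sum_congr rfl fun j _ => by rw [hZ _ le_rfl]
  · unfold firstInput
    split
    · rw [hc 0 hs.Np_pos]
      rfl
    · rfl

section Extended

variable {P : TubeMPC n m np nw} {q : P.Plan} {x : Vec n}

lemma Plan.Extended.mem_tubes (he : q.Extended) (h : q.Feasible x) {k : ℕ} (hk : P.Nr ≤ k)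
    (hk' : k ≤ P.Np + 1) (j : P.Node P.Nr) : q.Z k j ∈ P.tubes := by
  rcases Nat.le_or_eq_of_le_succ hk' with hk' | rfl
  · exact h.tube_mem k hk hk' j
  · exact he.tube_mem j

lemma Plan.Extended.subset_Zset (ht : P.TerminalAssumption) (he : q.Extended) (h : q.Feasible x)
    {k : ℕ} (hk : P.Nr ≤ k) (hk' : k ≤ P.Np + 1) (j : P.Node P.Nr) : q.Z k j ⊆ P.Zset := by
  rcases Nat.le_or_eq_of_le_succ hk' with hk' | rfl
  · rcases hk'.lt_or_eq with hk' | rfl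
    · exact h.tube_state k hk hk' j
    · exact (h.terminal j).trans ht.subset_Z
  · exact (he.terminal j).trans ht.subset_Z

/-- At `k = Np` the terminal controller takes over: the feed-forward vanishes and the additional
tube is the successor. -/
lemma Plan.Extended.step_mem (he : q.Extended) (h : q.Feasible x) {k : ℕ}
    (hk : P.Nr ≤ k) (hk' : k ≤ P.Np) (j : P.Node P.Nr) (i : Fin np) {y w : Vec n}
    (hy : y ∈ q.Z k j) (hw : w ∈ P.Wbar) :
    (P.A i + P.B i * P.Kf).mulVec y + (P.B i).mulVec (q.c k j) + w ∈ q.Z (k + 1) j := by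
  rcases hk'.lt_or_eq with hk' | rfl
  · exact h.tube_dynamics k hk hk' j i
      (Set.add_mem_add (Set.add_mem_add (Set.mem_image_of_mem _ hy) rfl) hw)
  · rw [he.c_eq, Matrix.mulVec_zero, add_zero]
    exact he.tube_dynamics j i (Set.add_mem_add (Set.mem_image_of_mem _ hy) hw)

lemma Plan.Extended.input_mem (ht : P.TerminalAssumption) (he : q.Extended) (h : q.Feasible x)
    {k : ℕ} (hk : P.Nr ≤ k) (hk' : k ≤ P.Np) (j : P.Node P.Nr) {y : Vec n} (hy : y ∈ q.Z k j) :
    q.c k j + P.Kf.mulVec y ∈ P.Vset := by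
  rcases hk'.lt_or_eq with hk' | rfl
  · exact h.tube_input k hk hk' j (Set.add_mem_add rfl (Set.mem_image_of_mem _ hy))
  · rw [he.c_eq, zero_add]
    exact ht.gain_subset_V (Set.mem_image_of_mem _ (h.terminal j hy))

/-- The tree has no stage `Nr + 1`, but a step from a leaf is a step inside the leaf's tube. This
puts the candidate's leaf states into their initial tubes. -/
lemma Plan.Extended.predicted_mem (he : q.Extended) (h : q.Feasible x) (hN : P.Nr ≤ P.Np)
    (J : P.Node (P.Nr + 1)) : q.predicted P.Nr J ∈ q.Z (P.Nr + 1) (Fin.tail J) := by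
  have := he.step_mem h le_rfl hN (Fin.tail J) (J 0).1 (h.tube_init (Fin.tail J)).1
    (subset_convexHull ℝ _ (Set.mem_range_self (J 0).2))
  convert this using 1
  rw [predicted, input_Nr, Matrix.mulVec_add, Matrix.add_mulVec, Matrix.mulVec_mulVec]
  abel

lemma Plan.Extended.tree_input_mem (ht : P.TerminalAssumption) (he : q.Extended)
    (h : q.Feasible x) (hN : P.Nr ≤ P.Np) {k : ℕ} (hk : k ≤ P.Nr) (j : P.Node k) :
    q.input k j ∈ P.Vset := by
  rcases hk.lt_or_eq with hk | rfl
  · rw [q.input_of_lt hk]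
    exact h.input_mem k hk j
  · rw [q.input_Nr]
    exact he.input_mem ht h le_rfl hN j (h.tube_init j).1

lemma Plan.Feasible.tree_state_mem (h : q.Feasible x) {k : ℕ} (hk : k ≤ P.Nr) (j : P.Node k) :
    q.z k j ∈ P.Zset := by
  rcases hk.lt_or_eq with hk | rfl
  · exact h.state_mem k hk j
  · exact (h.tube_init j).2 (h.tube_init j).1

end Extended

/-! ### The candidate plan and recursive feasibility -/

/-- The candidate plan at the successor state: the convex combination, with weights `w`, of the
subtrees that emanate from the root. -/
noncomputable def Plan.shift {P : TubeMPC n m np nw} (q : P.Plan) (w : Fin np × Fin nw → ℝ) :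
    P.Plan where
  z k j := ∑ d, w d • q.predicted k (P.prepend d j)
  v k j := ∑ d, w d • q.input (k + 1) (P.prepend d j)
  -- The old plan has one tube sequence per leaf, so a path of length `Nr + 1` uses the sequence of
  -- its ancestor at stage `Nr`.
  Z k j := ∑ d, w d • q.Z (k + 1) (P.shiftNode d j)
  c k j := ∑ d, w d • q.c (k + 1) (P.shiftNode d j)

/-- The affine dynamics commutes with convex combinations. -/
lemma sum_smul_affine {ι : Type*} [Fintype ι] {w : ι → ℝ} (h1 : ∑ i, w i = 1)
    {n₁ n₂ n₃ : ℕ} (A : Matrix (Fin n₁) (Fin n₂) ℝ) (B : Matrix (Fin n₁) (Fin n₃) ℝ)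
    (y : ι → Vec n₂) (u : ι → Vec n₃) (b : Vec n₁) :
    ∑ i, w i • (A.mulVec (y i) + B.mulVec (u i) + b) =
      A.mulVec (∑ i, w i • y i) + B.mulVec (∑ i, w i • u i) + b := by
  simp only [smul_add, Finset.sum_add_distrib, ← Finset.sum_smul, h1, one_smul, Matrix.mulVec_sum,
    Matrix.mulVec_smul]

lemma Plan.shift_root {P : TubeMPC n m np nw} (q : P.Plan) (w : Fin np × Fin nw → ℝ) :
    (q.shift w).root = ∑ d, w d • ((P.A d.1).mulVec q.root + (P.B d.1).mulVec q.firstInput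
      + P.wbar d.2) := by
  refine Finset.sum_congr rfl fun d _ => ?_
  rw [q.firstInput_eq]
  rw [Subsingleton.elim (Fin.elim0 : P.Node 0) (Fin.tail (P.prepend d Fin.elim0))]
  rw [root, Subsingleton.elim (Fin.elim0 : P.Node 0) (Fin.tail (P.prepend d Fin.elim0))]
  rfl

/-- Recursive feasibility. -/
lemma Plan.Feasible.shift {P : TubeMPC n m np nw} (hs : P.Standing) (ht : P.TerminalAssumption)
    {q : P.Plan} {x x' : Vec n} (h : q.Feasible x) (he : q.Extended)
    {w : Fin np × Fin nw → ℝ} (hw : ∀ d, 0 ≤ w d) (h1 : ∑ d, w d = 1)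
    (hx' : x' ∈ ({(q.shift w).root} : Set (Vec n)) + P.S) : (q.shift w).Feasible x' := by
  have hZc : Convex ℝ P.Zset := hs.X_polytope.convex.pontryaginDiff _
  have hVc : Convex ℝ P.Vset := hs.U_polytope.convex.pontryaginDiff _
  have hN := hs.Nr_le
  have hz : ∀ k, k < P.Nr → ∀ j, (q.shift w).z k j = ∑ d, w d • q.z (k + 1) (P.prepend d j) :=
    fun k hk j => Finset.sum_congr rfl fun d _ => by rw [h.predicted_eq hk]
  refine ⟨?_, ?_, ?_, ?_, ?_, ?_, ?_, ?_, ?_, hx'⟩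
  · intro k hk j e
    rw [hz k hk]
    refine Eq.trans ?_ (sum_smul_affine h1 _ _ _ _ _)
    refine Finset.sum_congr rfl fun d _ => ?_
    rw [prepend_cons]
    rfl
  · intro k hk j
    rw [hz k hk]
    exact hZc.sum_mem (fun d _ => hw d) h1 fun d _ => h.tree_state_mem hk _
  · intro k hk j
    exact hVc.sum_mem (fun d _ => hw d) h1 fun d _ => he.tree_input_mem ht h hN hk _
  · intro k hk hk' j
    exact sum_smul_mem_of_convexComb hs.tube_nonempty hs.tube_comb _ _ _
      (fun d _ => he.mem_tubes h (by omega) (by omega) _) (fun d _ => hw d) h1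
  · intro j
    refine ⟨?_, ?_⟩
    · exact mem_sum_smul_iff.2 ⟨_, fun d => he.predicted_mem h hN _, rfl⟩
    · exact hZc.sum_smul_subset (fun d => he.subset_Zset ht h (by omega) (by omega) _) hw h1
  · rintro k hk hk' j i _ ⟨_, ⟨_, ⟨y, hy, rfl⟩, _, rfl, rfl⟩, b, hb, rfl⟩
    obtain ⟨f, hf, rfl⟩ := mem_sum_smul_iff.1 hy
    -- One selection `f` from the summands serves all tubes; for `k + 1 = Np` the step leads into
    -- the additional tube.
    refine mem_sum_smul_iff.2 ⟨_, fun d => he.step_mem h (k := k + 1) (by omega) (by omega)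
      (P.shiftNode d j) i (hf d) hb, ?_⟩
    exact sum_smul_affine h1 _ _ _ _ _
  · intro k hk hk' j
    exact hZc.sum_smul_subset (fun d => he.subset_Zset ht h (by omega) (by omega) _) hw h1
  · rintro k hk hk' j _ ⟨_, rfl, _, ⟨y, hy, rfl⟩, rfl⟩
    obtain ⟨f, hf, rfl⟩ := mem_sum_smul_iff.1 hy
    have := hVc.sum_mem (fun d _ => hw d) h1 fun d (_ : d ∈ Finset.univ) =>
      he.input_mem ht h (k := k + 1) (by omega) (by omega) (P.shiftNode d j) (hf d)
    convert this using 1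
    simp only [smul_add, Finset.sum_add_distrib, Matrix.mulVec_sum, Matrix.mulVec_smul]
    rfl
  · intro j
    exact ht.polytope.convex.sum_smul_subset (fun d => he.terminal _) hw h1

end TubeMPC

/-! ### Decrease of the cost -/

namespace TubeMPC

variable {n m np nw : ℕ}

section Counting

variable (P : TubeMPC n m np nw)

lemma sum_prepend {k : ℕ} (g : P.Node (k + 1) → ℝ) :
    ∑ j : P.Node k, ∑ d, g (P.prepend d j) = ∑ J, g J := by
  rw [Finset.sum_comm, ← Fintype.sum_prod_type' (f := fun d j => g (P.prepend d j))]
  exact Fintype.sum_equiv (Fin.snocEquiv fun _ : Fin (k + 1) => Fin np × Fin nw) _ _ fun _ => rfl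

lemma sum_tail {k : ℕ} (g : P.Node k → ℝ) :
    ∑ J : P.Node (k + 1), g (Fin.tail J) = ((np * nw : ℕ) : ℝ) * ∑ j, g j := by
  rw [← Fintype.sum_equiv (Fin.consEquiv fun _ : Fin (k + 1) => Fin np × Fin nw)
    (fun p => g p.2) (fun J => g (Fin.tail J)) fun p => ?_, Fintype.sum_prod_type]
  · simp
  · exact congrArg g (Fin.tail_cons (α := fun _ => Fin np × Fin nw) p.1 p.2).symm

/-- Over all pairs `(d, j)`, `shiftNode` hits every node exactly `np * nw` times. This is the factor
by which the tube weights grow per stage. -/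
lemma sum_shiftNode_le {k : ℕ} {g : P.Node k → ℝ} (hg : ∀ j, 0 ≤ g j)
    {w : Fin np × Fin nw → ℝ} (hw : ∀ d, w d ≤ 1) :
    ∑ j : P.Node k, ∑ d, w d * g (P.shiftNode d j) ≤ ((np * nw : ℕ) : ℝ) * ∑ j, g j := by
  rw [← sum_tail, ← sum_prepend]
  exact Finset.sum_le_sum fun j _ => Finset.sum_le_sum fun d _ =>
    mul_le_of_le_one_left (hg _) (hw d)

end Counting

/-- The worst-case stage cost over a tube. -/
noncomputable def Plan.tubeStage {P : TubeMPC n m np nw} (q : P.Plan) (k : ℕ)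
    (j : P.Node P.Nr) : ℝ :=
  sSup ((fun y => P.stageCost y (q.c k j + P.Kf.mulVec y)) '' q.Z k j)

/-- The contribution of a stage to the objective. -/
noncomputable def Plan.stageTerm {P : TubeMPC n m np nw} (q : P.Plan) (k : ℕ) : ℝ :=
  if k < P.Nr then ∑ j : P.Node k, P.nodeWeight k j * P.stageCost (q.z k j) (q.v k j)
  else ∑ j : P.Node P.Nr, ((np * nw : ℕ) : ℝ) ^ (k - P.Nr) * P.weightTube * q.tubeStage k j

lemma Plan.cost_eq {P : TubeMPC n m np nw} (hN : P.Nr ≤ P.Np) (q : P.Plan) :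
    q.cost = ∑ k ∈ Finset.range P.Np, q.stageTerm k
      + ∑ j : P.Node P.Nr, sSup (P.termCost '' q.Z P.Np j) := by
  rw [cost]
  congr 1
  rw [← Finset.sum_range_add_sum_Ico _ hN]
  congr 1
  · exact Finset.sum_congr rfl fun k hk => (if_pos (Finset.mem_range.1 hk)).symm
  · exact Finset.sum_congr rfl fun k hk => (if_neg (Finset.mem_Ico.1 hk).1.not_gt).symm

section Cost

variable {P : TubeMPC n m np nw} {q : P.Plan} {x : Vec n} {p : ℝ≥0∞}

lemma CostAssumption.stage_continuous (hc : P.CostAssumption p) :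
    Continuous fun y : Vec n × Vec m => P.stageCost y.1 y.2 :=
  continuousOn_univ.1 (hc.stage_convex.continuousOn isOpen_univ)

lemma CostAssumption.tubeStage_nonneg (hc : P.CostAssumption p) (q : P.Plan) (k : ℕ)
    (j : P.Node P.Nr) : 0 ≤ q.tubeStage k j :=
  Real.sSup_nonneg (by rintro _ ⟨y, -, rfl⟩; exact hc.stage_nonneg _ _)

/-- Compactness and continuity of the convex stage cost make the supremum a genuine bound rather
than the default value of an unbounded `sSup`. -/
lemma CostAssumption.le_tubeStage (hc : P.CostAssumption p) {k : ℕ} {j : P.Node P.Nr}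
    (hZ : IsCompact (q.Z k j)) {y : Vec n} (hy : y ∈ q.Z k j) :
    P.stageCost y (q.c k j + P.Kf.mulVec y) ≤ q.tubeStage k j := by
  refine le_csSup (hZ.image ?_).bddAbove (Set.mem_image_of_mem _ hy)
  exact hc.stage_continuous.comp (continuous_id.prodMk
    (continuous_const.add (Continuous.matrix_mulVec continuous_const continuous_id)))

lemma CostAssumption.stage_sum_le (hc : P.CostAssumption p) {ι : Type*} [Fintype ι] {w : ι → ℝ}
    (hw : ∀ i, 0 ≤ w i) (h1 : ∑ i, w i = 1) (y : ι → Vec n) (u : ι → Vec m) :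
    P.stageCost (∑ i, w i • y i) (∑ i, w i • u i) ≤ ∑ i, w i * P.stageCost (y i) (u i) := by
  have := hc.stage_convex.map_sum_le (t := Finset.univ) (w := w) (p := fun i => (y i, u i))
    (fun i _ => hw i) h1 fun i _ => Set.mem_univ _
  simpa [Prod.fst_sum, Prod.snd_sum] using this

lemma CostAssumption.terminal_eq_zero (hc : P.CostAssumption p) {Z : Set (Vec n)}
    (hZ : Z ⊆ P.Zf) : sSup (P.termCost '' Z) = 0 := by
  refine le_antisymm (Real.sSup_nonpos ?_) (Real.sSup_nonneg ?_) <;>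
  · rintro _ ⟨y, hy, rfl⟩
    rw [hc.term_zero y (hZ hy)]

lemma CostAssumption.cost_nonneg (hs : P.Standing) (hω : P.WeightAssumption)
    (hc : P.CostAssumption p) (q : P.Plan) : 0 ≤ q.cost := by
  have hd : ∀ d, 0 ≤ P.weight d := fun d => hω.root_pos.le.trans (hω.root_le d)
  have ht : 0 ≤ P.weightTube := (hd (⟨0, hs.np_pos⟩, ⟨0, hs.nw_pos⟩)).trans (hω.le_tube _)
  rw [Plan.cost_eq hs.Nr_le]
  refine add_nonneg (Finset.sum_nonneg fun k _ => ?_) (Finset.sum_nonneg fun j _ =>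
    Real.sSup_nonneg (by rintro _ ⟨y, -, rfl⟩; exact hc.term_nonneg _))
  unfold Plan.stageTerm
  split
  · refine Finset.sum_nonneg fun j _ => mul_nonneg ?_ (hc.stage_nonneg _ _)
    cases k with
    | zero => exact hω.root_pos.le
    | succ k => exact hd _
  · exact Finset.sum_nonneg fun j _ => mul_nonneg (mul_nonneg (by positivity) ht)
      (hc.tubeStage_nonneg q k j)

/-- The weight of a node does not exceed the weight of its counterpart one stage later. -/
lemma WeightAssumption.nodeWeight_le (hω : P.WeightAssumption) {k : ℕ} (d : Fin np × Fin nw)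
    (j : P.Node k) : P.nodeWeight k j ≤ P.nodeWeight (k + 1) (P.prepend d j) := by
  cases k with
  | zero => exact hω.root_le _
  | succ k =>
    -- Prepending leaves the most recent realization, which alone fixes the weight, unchanged.
    refine le_of_eq (congrArg P.weight ?_)
    exact (Fin.snoc_castSucc (α := fun _ => Fin np × Fin nw) d j 0).symm

lemma WeightAssumption.nodeWeight_nonneg (hω : P.WeightAssumption) {k : ℕ} (j : P.Node k) :
    0 ≤ P.nodeWeight k j := by
  cases k with
  | zero => exact hω.root_pos.le
  | succ k => exact hω.root_pos.le.trans (hω.root_le _)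

/-- The stages of the candidate plan cost at most as much as the next stages of the plan. -/
lemma Plan.stageTerm_shift_le (hs : P.Standing) (hω : P.WeightAssumption)
    (hc : P.CostAssumption p) (h : q.Feasible x) (he : q.Extended)
    {w : Fin np × Fin nw → ℝ} (hw : ∀ d, 0 ≤ w d) (h1 : ∑ d, w d = 1) {k : ℕ} (hk : k < P.Np) :
    (q.shift w).stageTerm k ≤ q.stageTerm (k + 1) := by
  have hw1 : ∀ d, w d ≤ 1 := fun d =>
    h1 ▸ Finset.single_le_sum (fun d _ => hw d) (Finset.mem_univ d)
  have hdt : ∀ d, 0 ≤ P.weight d := fun d => hω.root_pos.le.trans (hω.root_le d)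
  have ht0 : 0 ≤ P.weightTube := (hdt (⟨0, hs.np_pos⟩, ⟨0, hs.nw_pos⟩)).trans (hω.le_tube _)
  have hcpt : ∀ k, P.Nr ≤ k → k ≤ P.Np + 1 → ∀ j, IsCompact (q.Z k j) := fun k hk hk' j =>
    hs.tube_compact _ (he.mem_tubes h hk hk' j)
  rcases lt_or_ge k P.Nr with hkr | hkr
  · have hle : (q.shift w).stageTerm k ≤ ∑ J : P.Node (k + 1),
        P.nodeWeight (k + 1) J * P.stageCost (q.z (k + 1) J) (q.input (k + 1) J) := by
      rw [stageTerm, if_pos hkr, ← sum_prepend]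
      refine Finset.sum_le_sum fun j _ => ?_
      refine (mul_le_mul_of_nonneg_left (hc.stage_sum_le hw h1 _ _)
        (hω.nodeWeight_nonneg j)).trans ?_
      rw [Finset.mul_sum]
      refine Finset.sum_le_sum fun d _ => ?_
      rw [h.predicted_eq hkr]
      -- Of the convex weights only `w d ≤ 1` is kept: the next stage pays for every realization in
      -- full.
      refine mul_le_mul (hω.nodeWeight_le d j) (mul_le_of_le_one_left (hc.stage_nonneg _ _) (hw1 d))
        (mul_nonneg (hw d) (hc.stage_nonneg _ _)) (hω.nodeWeight_nonneg _)
    refine hle.trans ?_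
    rcases (Nat.succ_le_of_lt hkr).lt_or_eq with hk1 | hk1
    · rw [stageTerm, if_pos hk1]
      exact Finset.sum_le_sum fun J _ => by rw [q.input_of_lt hk1]
    -- Here `k + 1 = Nr`: the last tree stage of the candidate is compared with the first tube
    -- stage, whose weight dominates and whose tubes contain the leaf states.
    · rw [stageTerm, if_neg (by omega)]
      have hwt : ∀ J : P.Node (k + 1), P.nodeWeight (k + 1) J ≤ P.weightTube := fun J =>
        hω.le_tube _
      -- The stage is generalized to `r` so that the types `Node r` and `Node Nr` can be identified
      -- by substitution.
      have hgoal : ∀ (r : ℕ) (hr : r = P.Nr), (∀ J : P.Node r, P.nodeWeight r J ≤ P.weightTube) →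
          ∑ J : P.Node r, P.nodeWeight r J * P.stageCost (q.z r J) (q.input r J) ≤
            ∑ j : P.Node P.Nr, ((np * nw : ℕ) : ℝ) ^ (r - P.Nr) * P.weightTube *
              q.tubeStage r j := by
        rintro _ rfl hwt
        refine Finset.sum_le_sum fun J _ => ?_
        rw [Nat.sub_self, pow_zero, one_mul, q.input_Nr]
        exact mul_le_mul (hwt J) (hc.le_tubeStage (hcpt _ le_rfl (by omega) J) (h.tube_init J).1)
          (hc.stage_nonneg _ _) ht0
      exact hgoal (k + 1) hk1 hwt
  · rw [stageTerm, if_neg hkr.not_gt, stageTerm, if_neg (by omega), ← Finset.mul_sum,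
      ← Finset.mul_sum]
    -- By Jensen, the maximum over a convex combination of tubes is at most that combination of the
    -- maxima.
    have hle : ∀ j, (q.shift w).tubeStage k j ≤
        ∑ d, w d * q.tubeStage (k + 1) (P.shiftNode d j) := by
      intro j
      refine Real.sSup_le ?_ (Finset.sum_nonneg fun d _ =>
        mul_nonneg (hw d) (hc.tubeStage_nonneg _ _ _))
      rintro _ ⟨y, hy, rfl⟩
      obtain ⟨f, hf, rfl⟩ := mem_sum_smul_iff.1 hy
      have hu : (q.shift w).c k j + P.Kf.mulVec (∑ d, w d • f d) =
          ∑ d, w d • (q.c (k + 1) (P.shiftNode d j) + P.Kf.mulVec (f d)) := by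
        simp only [smul_add, Finset.sum_add_distrib, Matrix.mulVec_sum, Matrix.mulVec_smul]
        rfl
      dsimp only
      rw [hu]
      refine (hc.stage_sum_le hw h1 _ _).trans (Finset.sum_le_sum fun d _ => ?_)
      exact mul_le_mul_of_nonneg_left
        (hc.le_tubeStage (hcpt _ (by omega) (by omega) _) (hf d)) (hw d)
    have hsum := (Finset.sum_le_sum fun j (_ : j ∈ Finset.univ) => hle j).trans
      (sum_shiftNode_le P (fun j => hc.tubeStage_nonneg q (k + 1) j) hw1)
    refine (mul_le_mul_of_nonneg_left hsum (mul_nonneg (by positivity) ht0)).trans (le_of_eq ?_)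
    rw [Nat.succ_sub hkr, pow_succ]
    ring

/-- The first stage costs at least the weighted stage cost of the root and the first input. -/
lemma Plan.le_stageTerm_zero (hs : P.Standing) (hω : P.WeightAssumption)
    (hc : P.CostAssumption p) (h : q.Feasible x) :
    P.weightRoot * P.stageCost q.root q.firstInput ≤ q.stageTerm 0 := by
  rw [q.firstInput_eq, root]
  rcases Nat.eq_zero_or_pos P.Nr with h0 | h0
  · have hwt : P.weightRoot ≤ P.weightTube :=
      (hω.root_le (⟨0, hs.np_pos⟩, ⟨0, hs.nw_pos⟩)).trans (hω.le_tube _)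
    rw [stageTerm, if_neg (by omega)]
    have hgoal : ∀ (r : ℕ) (_ : r = P.Nr) (J : P.Node r),
        P.weightRoot * P.stageCost (q.z r J) (q.input r J) ≤
          ∑ j : P.Node P.Nr, ((np * nw : ℕ) : ℝ) ^ (r - P.Nr) * P.weightTube *
            q.tubeStage r j := by
      rintro _ rfl J
      rw [Nat.sub_self, pow_zero, one_mul, q.input_Nr]
      have hZ := hs.tube_compact _ (h.tube_mem P.Nr le_rfl hs.Nr_le J)
      refine (mul_le_mul hwt (hc.le_tubeStage hZ (h.tube_init J).1) (hc.stage_nonneg _ _)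
        (hω.root_pos.le.trans hwt)).trans ?_
      exact Finset.single_le_sum (f := fun j => P.weightTube * q.tubeStage P.Nr j)
        (fun j _ => mul_nonneg (hω.root_pos.le.trans hwt) (hc.tubeStage_nonneg q _ j))
        (Finset.mem_univ J)
    exact hgoal 0 h0.symm _
  · rw [stageTerm, if_pos h0, q.input_of_lt h0, Fintype.sum_unique]
    exact le_of_eq (by rw [Subsingleton.elim (default : P.Node 0) Fin.elim0]; rfl)

/-- The candidate plan decreases the cost by at least the weighted stage cost of the root. -/
lemma Plan.cost_shift_le (hs : P.Standing) (hω : P.WeightAssumption)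
    (hc : P.CostAssumption p) (ht : P.TerminalAssumption) (h : q.Feasible x) (he : q.Extended)
    {w : Fin np × Fin nw → ℝ} (hw : ∀ d, 0 ≤ w d) (h1 : ∑ d, w d = 1) :
    (q.shift w).cost ≤ q.cost - P.weightRoot * P.stageCost q.root q.firstInput := by
  have hterm : ∀ j, (q.shift w).Z P.Np j ⊆ P.Zf := fun j =>
    ht.polytope.convex.sum_smul_subset (fun d => he.terminal _) hw h1
  -- Stage `Np` is not part of the cost; it is the last term of the shifted sum and vanishes since
  -- the feed-forward is zero and the tube lies in `Zf`.
  have hlast : q.stageTerm P.Np = 0 := by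
    rw [stageTerm, if_neg hs.Nr_le.not_gt]
    refine Finset.sum_eq_zero fun j _ => mul_eq_zero_of_right _ ?_
    refine le_antisymm (Real.sSup_nonpos ?_) (hc.tubeStage_nonneg _ _ _)
    rintro _ ⟨y, hy, rfl⟩
    dsimp only
    rw [he.c_eq, zero_add, hc.stage_zero y (h.terminal j hy)]
  have hsum := Finset.sum_le_sum fun k (hk : k ∈ Finset.range P.Np) =>
    stageTerm_shift_le hs hω hc h he hw h1 (Finset.mem_range.1 hk)
  have htele := Finset.sum_range_succ' q.stageTerm P.Np
  rw [Finset.sum_range_succ, hlast] at htele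
  have hfirst := le_stageTerm_zero hs hω hc h
  rw [cost_eq hs.Nr_le, cost_eq hs.Nr_le q,
    Finset.sum_eq_zero fun j _ => hc.terminal_eq_zero (hterm j),
    Finset.sum_eq_zero fun j _ => hc.terminal_eq_zero (h.terminal j)]
  linarith

end Cost

end TubeMPC

/-! ### The closed loop -/

namespace TubeMPC

variable {n m np nw : ℕ} {P : TubeMPC n m np nw} {p : ℝ≥0∞}

/-- One step of the nominal dynamics is a convex combination of the vertex realizations. -/
lemma exists_weights_step {g : SysPair n m} (hg : g ∈ P.pairs) {b : Vec n} (hb : b ∈ P.Wbar) :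
    ∃ w : Fin np × Fin nw → ℝ, (∀ d, 0 ≤ w d) ∧ ∑ d, w d = 1 ∧ ∀ (y : Vec n) (u : Vec m),
      ∑ d, w d • ((P.A d.1).mulVec y + (P.B d.1).mulVec u + P.wbar d.2) =
        g.1.mulVec y + g.2.mulVec u + b := by
  obtain ⟨μ, hμ0, hμ1, rfl⟩ := exists_weights_of_mem_convexHull_range _ hg
  obtain ⟨ν, hν0, hν1, rfl⟩ := exists_weights_of_mem_convexHull_range _ hb
  -- Product weights decouple the pair from the disturbance and depend on neither state nor input.
  refine ⟨fun d => μ d.1 * ν d.2, fun d => mul_nonneg (hμ0 _) (hν0 _), ?_, fun y u => ?_⟩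
  · rw [Fintype.sum_prod_type]
    simp only [← Finset.mul_sum, hν1, mul_one, hμ1]
  · rw [Fintype.sum_prod_type]
    have hinner : ∀ i, ∑ l, (μ i * ν l) • ((P.A i).mulVec y + (P.B i).mulVec u + P.wbar l) =
        μ i • ((P.A i).mulVec y + (P.B i).mulVec u) + μ i • ∑ l, ν l • P.wbar l := by
      intro i
      simp only [mul_smul, ← Finset.smul_sum, smul_add, Finset.sum_add_distrib, ← Finset.sum_smul,
        hν1, one_smul]
    simp only [hinner, Finset.sum_add_distrib, ← Finset.sum_smul, hμ1, one_smul]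
    congr 1
    simp only [Prod.fst_sum, Prod.snd_sum, Prod.smul_fst, Prod.smul_snd, Matrix.sum_mulVec,
      Matrix.smul_mulVec, smul_add, Finset.sum_add_distrib]

/-- Recursive feasibility and cost decrease along the closed loop. -/
lemma Plan.Feasible.exists_successor (hs : P.Standing) (hω : P.WeightAssumption)
    (hS : P.InvariantTubeAssumption) (ht : P.TerminalAssumption) (hc : P.CostAssumption p)
    {q : P.Plan} {x : Vec n} (h : q.Feasible x) {g : SysPair n m} (hg : g ∈ P.pairs)
    {b : Vec n} (hb : b ∈ P.W) :
    ∃ q' : P.Plan,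
      q'.Feasible (g.1.mulVec x + g.2.mulVec (q.firstInput + P.Kinv.mulVec (x - q.root)) + b) ∧
      q'.cost ≤ q.cost - P.weightRoot * P.stageCost q.root q.firstInput := by
  obtain ⟨q₁, h₁, he, hcost, hroot, hinput⟩ := h.exists_extended hs ht
  rw [← hcost, ← hroot, ← hinput]
  obtain ⟨_, rfl, s, hsS, hx⟩ := h₁.initial
  obtain ⟨b₁, hb₁, b₂, hb₂, rfl⟩ := hs.W_subset hb
  obtain ⟨w, hw, h1, hstep⟩ := exists_weights_step hg hb₁
  refine ⟨q₁.shift w, h₁.shift hs ht he hw h1 ?_, cost_shift_le hs hω hc ht h₁ he hw h1⟩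
  -- The error `s = x - root` evolves under `Kinv` and the small disturbance `b₂` only, so it stays
  -- in `S`.
  refine ⟨_, rfl, _, hS.invariant.convexHull_pairs hS.polytope.convex s hsS g hg b₂ hb₂, ?_⟩
  have hx : x = q₁.root + s := hx.symm
  simp only [shift_root, hstep, hx, add_sub_cancel_left, Matrix.mulVec_add, Matrix.add_mulVec,
    Matrix.mulVec_mulVec]
  abel

lemma Plan.Feasible.root_mem {q : P.Plan} {x : Vec n} (h : q.Feasible x) :
    q.root ∈ P.Zset :=
  h.tree_state_mem (Nat.zero_le _) _

lemma Plan.Feasible.mem_X {q : P.Plan} {x : Vec n} (h : q.Feasible x) :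
    x ∈ P.X := by
  obtain ⟨_, rfl, s, hsS, rfl⟩ := h.initial
  exact h.root_mem s hsS

/-- Outside `Xmax` the stage cost at the root is bounded below by a positive constant. -/
lemma exists_stageCost_lower (hS : P.InvariantTubeAssumption)
    (ht : P.TerminalAssumption) (hp : 1 ≤ p) (hc : P.CostAssumption p) {Xmax : Set (Vec n)}
    {κ : Vec n → Vec m} (hd : P.DualModeAssumption Xmax κ) :
    ∃ ε > 0, ∀ (q : P.Plan) (x : Vec n), q.Feasible x → x ∉ Xmax → ∀ v,
      ε ≤ P.stageCost q.root v := by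
  obtain ⟨c, hc0, hlow⟩ := hc.stage_lower
  obtain ⟨δ, hδ, hX⟩ := exists_uniform_relative_margin
    (ht.polytope.isCompact.add hS.polytope.isCompact) hd.terminal_inside
  refine ⟨c * δ, mul_pos hc0 hδ, fun q x h hx v => ?_⟩
  have hxX := h.mem_X
  obtain ⟨_, rfl, s, hsS, rfl⟩ := h.initial
  have hroot : q.root ∉ P.Zf := fun hz => hx (hd.terminal_subset (Set.add_mem_add hz hsS))
  refine (mul_le_mul_of_nonneg_left ?_ hc0.le).trans (hlow _ ⟨h.root_mem, hroot⟩ v)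
  refine le_setDist hp ht.polytope.nonempty fun y hy => ?_
  -- Were the root within `δ` of `y ∈ Zf`, then `x = root + s` would be within `δ` of `y + s ∈ Zf +
  -- S`, hence in `Xmax`.
  by_contra! hlt
  refine hx (hX _ hxX _ (Set.add_mem_add hy hsS) ?_)
  rwa [add_sub_add_right_eq_sub]

lemma IsTrajectory.shift {κ : Vec n → Vec m} {q : ℕ → SysPair n m} {w x : ℕ → Vec n}
    (h : P.IsTrajectory κ q w x) (s : ℕ) :
    P.IsTrajectory κ (fun t => q (s + t)) (fun t => w (s + t)) (fun t => x (s + t)) :=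
  ⟨fun t => h.pair_mem (s + t), fun t => h.dist_mem (s + t), fun t => h.step (s + t)⟩

/-- From every feasible state, the dual-mode closed loop enters `Xmax` in uniformly bounded time. -/
lemma exists_uniform_entry_Xmax (hs : P.Standing) (hω : P.WeightAssumption)
    (hS : P.InvariantTubeAssumption) (ht : P.TerminalAssumption) (hp : 1 ≤ p)
    (hc : P.CostAssumption p) {Xmax : Set (Vec n)} {κ : Vec n → Vec m}
    (hd : P.DualModeAssumption Xmax κ) {x₀ : Vec n} (hx₀ : x₀ ∈ P.feasibleSet) :
    ∃ N : ℕ, ∀ (q : ℕ → SysPair n m) (w x : ℕ → Vec n), P.IsTrajectory κ q w x → x 0 = x₀ →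
      ∃ t ≤ N, x t ∈ Xmax := by
  obtain ⟨ε, hε, hlow⟩ := exists_stageCost_lower hS ht hp hc hd
  obtain ⟨q₀, hq₀⟩ := hx₀.2
  have hη : 0 < P.weightRoot * ε := mul_pos hω.root_pos hε
  obtain ⟨N, hN⟩ := exists_nat_gt (q₀.cost / (P.weightRoot * ε))
  refine ⟨N, fun q w x htraj hx0 => ?_⟩
  by_contra! hout
  -- Each state carries some plan within the budget. The policy uses an optimal plan, which costs no
  -- more, and its candidate successor pays the next decrement.
  have key : ∀ t ≤ N, ∃ r : P.Plan, r.Feasible (x t) ∧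
      r.cost ≤ q₀.cost - t * (P.weightRoot * ε) := by
    intro t
    induction t with
    | zero => exact fun _ => ⟨q₀, hx0 ▸ hq₀, by simp⟩
    | succ t ih =>
      intro htN
      obtain ⟨r, hr, hrc⟩ := ih (by omega)
      have hxt := hout t (by omega)
      obtain ⟨r', hopt, hκ⟩ := hd.outer (x t) ⟨⟨hr.mem_X, r, hr⟩, hxt⟩
      obtain ⟨r'', hr'', hcost⟩ := hopt.1.exists_successor hs hω hS ht hc
        (htraj.pair_mem t) (htraj.dist_mem t)
      rw [← hκ, ← htraj.step] at hr''
      refine ⟨r'', hr'', ?_⟩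
      have hle := hopt.2 r hr
      have := mul_le_mul_of_nonneg_left (hlow r' (x t) hopt.1 hxt r'.firstInput) hω.root_pos.le
      push_cast
      linarith
  obtain ⟨r, -, hr⟩ := key N le_rfl
  rw [div_lt_iff₀ hη] at hN
  have := hc.cost_nonneg hs hω r
  linarith

/-- From `Xmax`, the closed loop is in `Z_f ⊕ S` after a uniform number of steps. -/
lemma exists_uniform_entry_terminal (hs : P.Standing) (hS : P.InvariantTubeAssumption)
    (ht : P.TerminalAssumption) {Xmax : Set (Vec n)} {κ : Vec n → Vec m}
    (hd : P.DualModeAssumption Xmax κ) {Smin : Set (Vec n)}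
    (hSmin : IsMinimalRPI P.vertexPairs P.Kf P.W Smin) (hinside : Smin ⊆ interior (P.Zf + P.S)) :
    ∃ N : ℕ, ∀ (q : ℕ → SysPair n m) (w x : ℕ → Vec n), P.IsTrajectory κ q w x → x 0 ∈ Xmax →
      x N ∈ P.Zf + P.S := by
  have hG : IsCompact (P.Zf + P.S) := ht.polytope.isCompact.add hS.polytope.isCompact
  obtain ⟨N, hN⟩ := IsStabilizing.exists_uniform_entry (M := P.vertexPairs) hd.stabilizing
    hSmin.nonempty (hG.of_isClosed_subset hSmin.isClosed (hinside.trans interior_subset))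
    hSmin.rpi (ht.polytope.convex.add hS.polytope.convex) hinside
    (hs.X_polytope.isCompact.isBounded.subset hd.subset_X)
  refine ⟨N, fun q w x htraj hx0 => ?_⟩
  -- The loop is linear only while in `Xmax`; invariance then keeps it there.
  have hlin : ∀ t, x t ∈ Xmax →
      x (t + 1) = ((q t).1 + (q t).2 * P.Kf).mulVec (x t) + w t := fun t hxt => by
    rw [htraj.step, hd.inner _ hxt, Matrix.add_mulVec, Matrix.mulVec_mulVec]
  have hmem : ∀ t, x t ∈ Xmax := by
    intro t
    induction t with
    | zero => exact hx0
    | succ t ih =>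
      rw [hlin t ih]
      exact hd.rpi _ ih _ (htraj.pair_mem t) _ (htraj.dist_mem t)
  exact hN q w x htraj.pair_mem htraj.dist_mem (fun t => hlin t (hmem t)) hx0

end TubeMPC

theorem mainTheorem10 {n m np nw : ℕ} (P : TubeMPC n m np nw) (p : ℝ≥0∞) (hp : 1 ≤ p)
    (hstanding : P.Standing)
    (hweights : P.WeightAssumption)
    (htube : P.InvariantTubeAssumption)
    (hterminal : P.TerminalAssumption)
    (hcost : P.CostAssumption p)
    (Xmax : Set (Vec n)) (κ : Vec n → Vec m)
    (hdual : P.DualModeAssumption Xmax κ)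
    (Smin : Set (Vec n)) (hSmin : IsMinimalRPI P.vertexPairs P.Kf P.W Smin)
    (hinside : Smin ⊆ interior (P.Zf + P.S)) :
    ∀ x₀ ∈ P.feasibleSet ∪ Xmax, ∃ N : ℕ,
      ∀ (q : ℕ → SysPair n m) (w x : ℕ → Vec n), P.IsTrajectory κ q w x → x 0 = x₀ →
        ∃ t ≤ N, x t ∈ P.Zf + P.S := by
  intro x₀ hx₀
  obtain ⟨N₂, hN₂⟩ := TubeMPC.exists_uniform_entry_terminal hstanding htube hterminal hdual hSmin
    hinside
  have hentry : ∃ N₁ : ℕ, ∀ (q : ℕ → SysPair n m) (w x : ℕ → Vec n), P.IsTrajectory κ q w x →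
      x 0 = x₀ → ∃ t ≤ N₁, x t ∈ Xmax := by
    rcases hx₀ with hx₀ | hx₀
    · exact TubeMPC.exists_uniform_entry_Xmax hstanding hweights htube hterminal hp hcost hdual hx₀
    · exact ⟨0, fun _ _ _ _ hx0 => ⟨0, le_rfl, hx0 ▸ hx₀⟩⟩
  obtain ⟨N₁, hN₁⟩ := hentry
  -- The entry state and time depend on the trajectory, but `N₂` is uniform over `Xmax`, so it
  -- applies to the trajectory restarted at entry.
  refine ⟨N₁ + N₂, fun q w x htraj hx0 => ?_⟩
  obtain ⟨t, ht, hxt⟩ := hN₁ q w x htraj hx0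
  exact ⟨t + N₂, by omega, hN₂ _ _ _ (htraj.shift t) hxt⟩
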